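/- Let $X$ be a finite-dimensional real or complex inner product space, and let $\Lambda X$ be its Grassmann (exterior) algebra with the inner product given on $p$-blades by $\langle v_1\wedge\dots\wedge v_p, w_1\wedge\dots\wedge w_p\rangle=\det(\langle v_i,w_j\rangle)$, extended sesquilinearly, with $\langle\nu,\omega\rangle=\bar\nu\,\omega$ on scalars and with distinct $\Lambda^pX$'s mutually orthogonal. For non-empty compact subsets $S,T$ of a metric space $(M,d)$, the directed Hausdorff distance from $S$ to $T$ is $h(S,T)=\max_{s\in S}d(s,T)$, where $d(s,T)=\min_{t\in T}d(s,t)$. For nonzero subspaces $V,W\subset X$ with $p=\dim V$, $q=\dim W$, $m=\min\{p,q\}$, the principal angles $0\le\theta_1\le\dots\le\theta_m\le\frac{\pi}{2}$ are the (unique) numbers for which there are orthonormal bases $(e_1,\dots,e_p)$ of $V$ and $(f_1,\dots,f_q)$ of $W$ with $\langle e_i,f_j\rangle=\delta_{ij}\cos\theta_i$. The Grassmann angle $\Theta_{V,W}\in[0,\frac{\pi}{2}]$ is $\arccos(\cos\theta_1\cdots\cos\theta_m)$ if $p\le q$, and $\frac{\pi}{2}$ if $p>q$; moreover $\Theta_{\{0\},W}=0$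 for every $W$ (including $W=\{0\}$), and $\Theta_{V,\{0\}}=\frac{\pi}{2}$ for $V\ne\{0\}$. For a subspace $V\subset X$, let $G(V)$ be the set of all subspaces of $V$ (of all dimensions $k=0,\dots,\dim V$), embedded in the projective space $\mathbb{P}(\Lambda X)$ by sending a $k$-dimensional subspace $U$ to the line $\Lambda^kU$, where $\mathbb{P}(\Lambda X)$ has the Fubini–Study distance $d_{FS}(\operatorname{span}(\nu),\operatorname{span}(\omega))=\arccos\frac{|\langle\nu,\omega\rangle|}{\|\nu\|\|\omega\|}$. Let $\tilde G(V)$ be the set of oriented subspaces of $V$, where an orientation of a $k$-dimensional subspace $U$ is a unit element of $\Lambda^kU$; it is embedded as the set of unit blades of $\Lambda V$ in the unit sphere $S(\Lambda X)$, which has the Euclidean angle distance $d(\nu,\omega)=\arccos(\operatorname{Re}\langle\nu,\omega\rangle)$. **Proposition.** For all subspaces $V,W\subset X$, $$h\big(G(V),G(W)\big)=\Theta_{V,W}\ \text{ in } \mathbb{P}(\Lambda X),\qquad\text{and}\qquad h\big(\tilde G(V),\tilde G(W)\big)=\Theta_{V,W}\ \text{ in } S(\Lambda X),$$ and in both cases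 the minima and the maximum in the definition of $h$ are attained. -/

import Mathlib

open Module

noncomputable section

/-! ### The inner product of the Grassmann algebra `ΛX` -/

section GrassmannInner

variable {𝕜 : Type*} [RCLike 𝕜] {X : Type*} [NormedAddCommGroup X] [InnerProductSpace 𝕜 X]

/-- The linear functional `⟪w₁ ∧ … ∧ wₚ, ·⟫` on `Λᵖ X`,
given on blades by `v₁ ∧ … ∧ vₚ ↦ det ⟪wᵢ, vⱼ⟫`. -/
def bladeFunctional (p : ℕ) (w : Fin p → X) : Module.Dual 𝕜 (⋀[𝕜]^p X) :=
  exteriorPower.alternatingMapToDual 𝕜 X p (fun i => (innerSL 𝕜 (w i)).toLinearMap)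

theorem bladeFunctional_ιMulti (p : ℕ) (w v : Fin p → X) :
    bladeFunctional (𝕜 := 𝕜) p w (exteriorPower.ιMulti 𝕜 p v)
      = Matrix.det (Matrix.of fun i j => inner 𝕜 (w i) (v j)) := by
  rw [bladeFunctional, exteriorPower.alternatingMapToDual_apply_ιMulti, ← Matrix.det_transpose]
  rfl

theorem innerSL_update {p : ℕ} [DecidableEq (Fin p)] (m : Fin p → X) (i : Fin p) (z : X) :
    (fun j => (innerSL 𝕜 (Function.update m i z j)).toLinearMap)
      = Function.update (fun j => (innerSL 𝕜 (m j)).toLinearMap) i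
          (innerSL 𝕜 z).toLinearMap := by
  funext j
  by_cases hj : j = i
  · subst hj; simp
  · simp [hj]

/-- `w₁, …, wₚ ↦ ⟪·, w₁ ∧ … ∧ wₚ⟫`, as an alternating map with values in the conjugate-linear
functionals on `Λᵖ X`. -/
def bladeConjFunctional (p : ℕ) : X [⋀^Fin p]→ₗ[𝕜] ((⋀[𝕜]^p X) →ₗ⋆[𝕜] 𝕜) where
  toFun w := (starRingEnd 𝕜).toSemilinearMap.comp (bladeFunctional (𝕜 := 𝕜) p w)
  map_update_add' := by
    intro _ m i x y
    refine LinearMap.ext fun ν => ?_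
    have e : (innerSL 𝕜 (x + y)).toLinearMap
        = (innerSL 𝕜 x).toLinearMap + (innerSL 𝕜 y).toLinearMap := by ext; simp
    have h : bladeFunctional (𝕜 := 𝕜) p (Function.update m i (x + y))
        = bladeFunctional p (Function.update m i x) + bladeFunctional p (Function.update m i y) := by
      simp only [bladeFunctional, innerSL_update, e, AlternatingMap.map_update_add]
    simp only [LinearMap.comp_apply, LinearMap.add_apply, h, map_add]
  map_update_smul' := by
    intro _ m i c x
    refine LinearMap.ext fun ν => ?_
    have e : (innerSL 𝕜 (c • x)).toLinearMap
        = (starRingEnd 𝕜 c) • (innerSL 𝕜 x).toLinearMap := by ext; simp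
    simp only [bladeFunctional, LinearMap.comp_apply, LinearMap.smul_apply, innerSL_update, e,
      AlternatingMap.map_update_smul, smul_eq_mul]
    simp [RingHom.toSemilinearMap]
  map_eq_zero_of_eq' := by
    intro w i j h hij
    refine LinearMap.ext fun ν => ?_
    have : bladeFunctional (𝕜 := 𝕜) p w = 0 :=
      AlternatingMap.map_eq_zero_of_eq _ _ (by simp only [h]) hij
    simp [this]

/-- The inner product of `Λᵖ X`, as the linear map `ω ↦ ⟪·, ω⟫`. -/
def gradeInner (p : ℕ) : (⋀[𝕜]^p X) →ₗ[𝕜] ((⋀[𝕜]^p X) →ₗ⋆[𝕜] 𝕜) :=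
  exteriorPower.alternatingMapLinearEquiv (bladeConjFunctional p)

theorem gradeInner_ιMulti_left (p : ℕ) (w : Fin p → X) (ν : ⋀[𝕜]^p X) :
    gradeInner (𝕜 := 𝕜) p (exteriorPower.ιMulti 𝕜 p w) ν
      = starRingEnd 𝕜 (bladeFunctional p w ν) := by
  rw [gradeInner, exteriorPower.alternatingMapLinearEquiv_apply_ιMulti]
  rfl

variable [FiniteDimensional 𝕜 X]

theorem gradeInner_eq_sum (p : ℕ) (ω ν : ⋀[𝕜]^p X) :
    gradeInner (𝕜 := 𝕜) p ω ν
      = ∑ s, starRingEnd 𝕜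
            (((stdOrthonormalBasis 𝕜 X).toBasis.exteriorPower p).repr ν s)
          * ((stdOrthonormalBasis 𝕜 X).toBasis.exteriorPower p).repr ω s := by
  set b := (stdOrthonormalBasis 𝕜 X).toBasis with hb
  have key (s) : gradeInner (𝕜 := 𝕜) p (b.exteriorPower p s) ν
      = starRingEnd 𝕜 ((b.exteriorPower p).repr ν s) := by
    rw [exteriorPower.basis_repr_apply, exteriorPower.basis_apply, exteriorPower.ιMulti_family,
      gradeInner_ιMulti_left, exteriorPower.ιMultiDual, exteriorPower.ιMulti_family,
      exteriorPower.pairingDual, exteriorPower.alternatingMapLinearEquiv_apply_ιMulti,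
      bladeFunctional]
    congr 3
    funext i
    ext x
    simp [hb, OrthonormalBasis.repr_apply_apply]
  conv_lhs => rw [← (b.exteriorPower p).sum_repr ω]
  simp only [map_sum, LinearMap.sum_apply, map_smul, LinearMap.smul_apply, key, smul_eq_mul]
  exact Finset.sum_congr rfl fun s _ => mul_comm _ _

/-- The homogeneous component of grade `p` of a multivector. -/
abbrev gradePart (p : ℕ) (ν : ExteriorAlgebra 𝕜 X) : ⋀[𝕜]^p X :=
  DirectSum.decompose (fun q : ℕ => ⋀[𝕜]^q X) ν p

/-- The inner product of `ΛX`: on each `Λᵖ X` it is the sesquilinear extension of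
`⟪v₁ ∧ … ∧ vₚ, w₁ ∧ … ∧ wₚ⟫ = det ⟪vᵢ, wⱼ⟫`, and distinct `Λᵖ X`'s are orthogonal.
(Grades above `dim X` are zero.) -/
def grassmannInner (ν ω : ExteriorAlgebra 𝕜 X) : 𝕜 :=
  ∑ p ∈ Finset.range (finrank 𝕜 X + 1), gradeInner p (gradePart p ω) (gradePart p ν)

theorem gradeInner_self (p : ℕ) (ν : ⋀[𝕜]^p X) :
    gradeInner (𝕜 := 𝕜) p ν ν = ((∑ s, ‖((stdOrthonormalBasis 𝕜 X).toBasis.exteriorPower p).repr ν s‖ ^ 2 : ℝ) : 𝕜) := by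
  rw [gradeInner_eq_sum]
  push_cast
  exact Finset.sum_congr rfl fun s _ => RCLike.conj_mul _

theorem gradePart_eq_zero (p : ℕ) (hp : finrank 𝕜 X < p) (ν : ExteriorAlgebra 𝕜 X) :
    gradePart (𝕜 := 𝕜) p ν = 0 := by
  have h : finrank 𝕜 (⋀[𝕜]^p X) = 0 := by
    rw [exteriorPower.finrank_eq, Nat.choose_eq_zero_of_lt hp]
  have := finrank_zero_iff.mp h
  exact Subsingleton.elim _ _

theorem grassmannInner_conj_symm (ν ω : ExteriorAlgebra 𝕜 X) :
    starRingEnd 𝕜 (grassmannInner ω ν) = grassmannInner ν ω := by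
  rw [grassmannInner, grassmannInner, map_sum]
  refine Finset.sum_congr rfl fun p _ => ?_
  rw [gradeInner_eq_sum, gradeInner_eq_sum, map_sum]
  refine Finset.sum_congr rfl fun s _ => ?_
  rw [map_mul, RCLike.conj_conj, mul_comm]

theorem grassmannInner_self (ν : ExteriorAlgebra 𝕜 X) :
    grassmannInner ν ν = ((∑ p ∈ Finset.range (finrank 𝕜 X + 1), ∑ s,
        ‖((stdOrthonormalBasis 𝕜 X).toBasis.exteriorPower p).repr (gradePart p ν) s‖ ^ 2 : ℝ) : 𝕜) := by
  rw [grassmannInner, RCLike.ofReal_sum]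
  exact Finset.sum_congr rfl fun p _ => gradeInner_self p _

theorem grassmannInner_definite (ν : ExteriorAlgebra 𝕜 X) (h : grassmannInner ν ν = 0) :
    ν = 0 := by
  rw [grassmannInner_self, RCLike.ofReal_eq_zero] at h
  have h0 (p : ℕ) : gradePart p ν = 0 := by
    by_cases hp : finrank 𝕜 X < p
    · exact gradePart_eq_zero p hp ν
    · have h3 := (Finset.sum_eq_zero_iff_of_nonneg fun _ _ => by positivity).mp h p
        (Finset.mem_range.mpr (by omega))
      have h4 := (Finset.sum_eq_zero_iff_of_nonneg fun _ _ => by positivity).mp h3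
      refine ((stdOrthonormalBasis 𝕜 X).toBasis.exteriorPower p).ext_elem fun s => ?_
      simpa using h4 s (Finset.mem_univ s)
  apply (DirectSum.decompose (fun q : ℕ => ⋀[𝕜]^q X)).injective
  rw [DirectSum.decompose_zero]
  exact DFinsupp.ext h0

/-- The inner product axioms for `ΛX`. -/
@[reducible] def grassmannCore : InnerProductSpace.Core 𝕜 (ExteriorAlgebra 𝕜 X) where
  inner := grassmannInner
  conj_inner_symm := grassmannInner_conj_symm
  re_inner_nonneg ν := by
    show 0 ≤ RCLike.re (grassmannInner ν ν)
    rw [grassmannInner_self, RCLike.ofReal_re]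
    positivity
  add_left ν ν' ω := by
    show grassmannInner (ν + ν') ω = grassmannInner ν ω + grassmannInner ν' ω
    simp only [grassmannInner, gradePart, DirectSum.decompose_add, DirectSum.add_apply, map_add,
      Finset.sum_add_distrib]
  smul_left ν ω c := by
    show grassmannInner (c • ν) ω = starRingEnd 𝕜 c * grassmannInner ν ω
    simp only [grassmannInner, gradePart, DirectSum.decompose_smul, DirectSum.smul_apply,
      LinearMap.map_smulₛₗ, smul_eq_mul, Finset.mul_sum]
  definite := grassmannInner_definite

instance : NormedAddCommGroup (ExteriorAlgebra 𝕜 X) :=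
  (grassmannCore (𝕜 := 𝕜) (X := X)).toNormedAddCommGroup

instance : InnerProductSpace 𝕜 (ExteriorAlgebra 𝕜 X) :=
  InnerProductSpace.ofCore (grassmannCore (𝕜 := 𝕜) (X := X)).toCore

theorem inner_coe_grade (p : ℕ) (ν ω : ⋀[𝕜]^p X) :
    inner 𝕜 (ν : ExteriorAlgebra 𝕜 X) (ω : ExteriorAlgebra 𝕜 X) = gradeInner p ω ν := by
  show grassmannInner (ν : ExteriorAlgebra 𝕜 X) (ω : ExteriorAlgebra 𝕜 X) = _
  have hp : gradePart p (ν : ExteriorAlgebra 𝕜 X) = ν := by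
    simp [gradePart, DirectSum.decompose_coe, DirectSum.of_eq_same]
  have hp' : gradePart p (ω : ExteriorAlgebra 𝕜 X) = ω := by
    simp [gradePart, DirectSum.decompose_coe, DirectSum.of_eq_same]
  rw [grassmannInner, Finset.sum_eq_single p, hp, hp']
  · intro q _ hq
    have : gradePart q (ν : ExteriorAlgebra 𝕜 X) = 0 := by
      rw [gradePart, DirectSum.decompose_coe, DirectSum.of_eq_of_ne _ _ _ hq]
    rw [this, map_zero]
  · intro h
    rw [gradePart_eq_zero p (by simpa using h), map_zero]
    simp

/-- The defining formula for blades of equal grade. -/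
theorem inner_ιMulti_ιMulti (p : ℕ) (v w : Fin p → X) :
    inner 𝕜 (ExteriorAlgebra.ιMulti 𝕜 p v) (ExteriorAlgebra.ιMulti 𝕜 p w)
      = Matrix.det (Matrix.of fun i j => inner 𝕜 (v i) (w j)) := by
  rw [← exteriorPower.ιMulti_apply_coe, ← exteriorPower.ιMulti_apply_coe, inner_coe_grade,
    gradeInner_ιMulti_left, bladeFunctional_ιMulti, RingHom.map_det, ← Matrix.det_transpose]
  congr 1
  ext i j
  simp

/-- Multivectors of distinct grades are orthogonal. -/
theorem inner_eq_zero_of_grade_ne {p q : ℕ} (hpq : p ≠ q) (ν : ⋀[𝕜]^p X) (ω : ⋀[𝕜]^q X) :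
    inner 𝕜 (ν : ExteriorAlgebra 𝕜 X) (ω : ExteriorAlgebra 𝕜 X) = 0 := by
  show grassmannInner (ν : ExteriorAlgebra 𝕜 X) (ω : ExteriorAlgebra 𝕜 X) = _
  refine Finset.sum_eq_zero fun r _ => ?_
  by_cases hr : r = p
  · have : gradePart r (ω : ExteriorAlgebra 𝕜 X) = 0 := by
      rw [gradePart, DirectSum.decompose_coe, DirectSum.of_eq_of_ne _ _ _ (hr ▸ hpq)]
    rw [this, map_zero, LinearMap.zero_apply]
  · have : gradePart r (ν : ExteriorAlgebra 𝕜 X) = 0 := by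
      rw [gradePart, DirectSum.decompose_coe, DirectSum.of_eq_of_ne _ _ _ hr]
    rw [this, map_zero]

end GrassmannInner

/-! ### The Fubini–Study metric on a projective space -/

section Metrics

variable {𝕜 : Type*} [RCLike 𝕜] {E : Type*} [NormedAddCommGroup E] [InnerProductSpace 𝕜 E]

open Real in
/-- For unit vectors, `arccos (Re ⟪·,·⟫)` satisfies the triangle inequality. -/
theorem arccos_re_inner_triangle (u v w : E) (hu : ‖u‖ = 1) (hv : ‖v‖ = 1) (hw : ‖w‖ = 1) :
    arccos (RCLike.re (inner 𝕜 u w))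
      ≤ arccos (RCLike.re (inner 𝕜 u v)) + arccos (RCLike.re (inner 𝕜 v w)) := by
  let _ : InnerProductSpace ℝ E := InnerProductSpace.rclikeToReal 𝕜 E
  have h := InnerProductGeometry.angle_le_angle_add_angle u v w
  simp only [InnerProductGeometry.angle, hu, hv, hw, mul_one, div_one] at h
  exact h

/-- The Fubini–Study distance between the lines of `v` and `w`. -/
def lineAngle (𝕜 : Type*) [RCLike 𝕜] {E : Type*} [NormedAddCommGroup E] [InnerProductSpace 𝕜 E]
    (v w : E) : ℝ :=
  Real.arccos (‖inner 𝕜 v w‖ / (‖v‖ * ‖w‖))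

theorem lineAngle_smul {c d : 𝕜} (hc : c ≠ 0) (hd : d ≠ 0) (v w : E) :
    lineAngle 𝕜 (c • v) (d • w) = lineAngle 𝕜 v w := by
  have hc' : ‖c‖ ≠ 0 := norm_ne_zero_iff.mpr hc
  have hd' : ‖d‖ ≠ 0 := norm_ne_zero_iff.mpr hd
  rw [lineAngle, lineAngle, inner_smul_left, inner_smul_right, norm_mul, norm_mul, norm_smul,
    norm_smul, RCLike.norm_conj]
  congr 1
  rw [show ‖c‖ * (‖d‖ * ‖inner 𝕜 v w‖) = (‖c‖ * ‖d‖) * ‖inner 𝕜 v w‖ by ring,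
    show ‖c‖ * ‖v‖ * (‖d‖ * ‖w‖) = (‖c‖ * ‖d‖) * (‖v‖ * ‖w‖) by ring]
  exact mul_div_mul_left _ _ (mul_ne_zero hc' hd')

theorem lineAngle_comm (v w : E) : lineAngle 𝕜 v w = lineAngle 𝕜 w v := by
  rw [lineAngle, lineAngle, norm_inner_symm, mul_comm]

theorem lineAngle_triangle_unit (u v w : E) (hu : ‖u‖ = 1) (hv : ‖v‖ = 1) (hw : ‖w‖ = 1) :
    lineAngle 𝕜 u w ≤ lineAngle 𝕜 u v + lineAngle 𝕜 v w := by
  obtain ⟨c, hc, hc'⟩ := RCLike.exists_norm_eq_mul_self (inner 𝕜 v u)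
  obtain ⟨d, hd, hd'⟩ := RCLike.exists_norm_eq_mul_self (inner 𝕜 v w)
  have h := arccos_re_inner_triangle (𝕜 := 𝕜) (c • u) v (d • w)
    (by rw [norm_smul, hc, hu, one_mul]) hv (by rw [norm_smul, hd, hw, one_mul])
  have e1 : RCLike.re (inner 𝕜 (c • u) v) = ‖inner 𝕜 u v‖ := by
    rw [inner_re_symm, inner_smul_right, ← hc', RCLike.ofReal_re, norm_inner_symm]
  have e2 : RCLike.re (inner 𝕜 v (d • w)) = ‖inner 𝕜 v w‖ := by
    rw [inner_smul_right, ← hd', RCLike.ofReal_re]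
  have e3 : RCLike.re (inner 𝕜 (c • u) (d • w)) ≤ ‖inner 𝕜 u w‖ := by
    refine (RCLike.re_le_norm _).trans (le_of_eq ?_)
    rw [inner_smul_left, inner_smul_right, norm_mul, norm_mul, RCLike.norm_conj, hc, hd, one_mul,
      one_mul]
  rw [e1, e2] at h
  simp only [lineAngle, hu, hv, hw, mul_one, div_one]
  exact (Real.arccos_le_arccos e3).trans h

theorem lineAngle_triangle (u v w : E) (hu : u ≠ 0) (hv : v ≠ 0) (hw : w ≠ 0) :
    lineAngle 𝕜 u w ≤ lineAngle 𝕜 u v + lineAngle 𝕜 v w := by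
  have hne {x : E} (hx : x ≠ 0) : ((‖x‖⁻¹ : ℝ) : 𝕜) ≠ 0 := by simpa using hx
  have hn {x : E} (hx : x ≠ 0) : ‖((‖x‖⁻¹ : ℝ) : 𝕜) • x‖ = 1 := by
    rw [norm_smul, RCLike.norm_ofReal, abs_of_nonneg (by positivity)]
    exact inv_mul_cancel₀ (norm_ne_zero_iff.mpr hx)
  have h := lineAngle_triangle_unit (𝕜 := 𝕜) _ _ _ (hn hu) (hn hv) (hn hw)
  rwa [lineAngle_smul (hne hu) (hne hw) u w, lineAngle_smul (hne hu) (hne hv) u v,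
    lineAngle_smul (hne hv) (hne hw) v w] at h

/-- The projective space of `E` with the Fubini–Study metric
`d (span v) (span w) = arccos (|⟪v, w⟫| / (‖v‖ ‖w‖))`. -/
instance : MetricSpace (Projectivization 𝕜 E) where
  dist L M := lineAngle 𝕜 L.rep M.rep
  dist_self L := by
    have : ‖L.rep‖ * ‖L.rep‖ ≠ 0 := by simpa using L.rep_nonzero
    show lineAngle 𝕜 L.rep L.rep = 0
    rw [lineAngle, norm_inner_eq_norm_iff L.rep_nonzero L.rep_nonzero |>.mpr
      ⟨1, one_ne_zero, (one_smul _ _).symm⟩, div_self this, Real.arccos_one]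
  dist_comm L M := lineAngle_comm _ _
  dist_triangle L M N := lineAngle_triangle _ _ _ L.rep_nonzero M.rep_nonzero N.rep_nonzero
  eq_of_dist_eq_zero {L M} h := by
    have hpos : 0 < ‖L.rep‖ * ‖M.rep‖ :=
      mul_pos (norm_pos_iff.mpr L.rep_nonzero) (norm_pos_iff.mpr M.rep_nonzero)
    have h1 : ‖inner 𝕜 L.rep M.rep‖ = ‖L.rep‖ * ‖M.rep‖ := by
      have := Real.arccos_eq_zero.mp h
      rw [le_div_iff₀ hpos, one_mul] at this
      exact le_antisymm (norm_inner_le_norm _ _) this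
    obtain ⟨r, hr, hr'⟩ := (norm_inner_eq_norm_iff L.rep_nonzero M.rep_nonzero).mp h1
    rw [← L.mk_rep, ← M.mk_rep, eq_comm, Projectivization.mk_eq_mk_iff']
    exact ⟨r, hr'.symm⟩

theorem fubiniStudy_dist_mk (v w : E) (hv : v ≠ 0) (hw : w ≠ 0) :
    dist (Projectivization.mk 𝕜 v hv) (Projectivization.mk 𝕜 w hw)
      = Real.arccos (‖inner 𝕜 v w‖ / (‖v‖ * ‖w‖)) := by
  obtain ⟨a, ha⟩ := Projectivization.exists_smul_eq_mk_rep 𝕜 v hv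
  obtain ⟨b, hb⟩ := Projectivization.exists_smul_eq_mk_rep 𝕜 w hw
  show lineAngle 𝕜 _ _ = lineAngle 𝕜 v w
  rw [← ha, ← hb]
  exact lineAngle_smul a.ne_zero b.ne_zero v w

/-- The unit sphere of `E`. -/
def AngularSphere (𝕜 : Type*) [RCLike 𝕜] (E : Type*) [NormedAddCommGroup E]
    [InnerProductSpace 𝕜 E] : Type _ :=
  {v : E // ‖v‖ = 1}

/-- The unit sphere with the distance given by the Euclidean angle
`θ_{v,w} = arccos (Re ⟪v, w⟫)`. -/
instance : MetricSpace (AngularSphere 𝕜 E) where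
  dist v w := Real.arccos (RCLike.re (inner 𝕜 v.1 w.1))
  dist_self v := by
    have h : RCLike.re (inner 𝕜 v.1 v.1) = 1 := by
      rw [inner_self_eq_norm_sq, v.2, one_pow]
    show Real.arccos (RCLike.re (inner 𝕜 v.1 v.1)) = 0
    rw [h, Real.arccos_one]
  dist_comm v w := by
    show Real.arccos (RCLike.re (inner 𝕜 v.1 w.1)) = Real.arccos (RCLike.re (inner 𝕜 w.1 v.1))
    rw [inner_re_symm]
  dist_triangle u v w := arccos_re_inner_triangle _ _ _ u.2 v.2 w.2
  eq_of_dist_eq_zero {v w} h := by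
    have h1 : 1 ≤ RCLike.re (inner 𝕜 v.1 w.1) := Real.arccos_eq_zero.mp h
    have h2 := norm_sub_sq (𝕜 := 𝕜) v.1 w.1
    rw [v.2, w.2] at h2
    have h3 : ‖v.1 - w.1‖ = 0 := by nlinarith [norm_nonneg (v.1 - w.1)]
    exact Subtype.ext (sub_eq_zero.mp (norm_eq_zero.mp h3))

/-- The directed Hausdorff distance `h(S, T)` from `S` to `T`: the largest
distance `d(s, T)` of a point `s` of `S` from `T`, where `d(s, T)` is the infimum of the `d(s, t)`
for `t` in `T`. -/
def directedHausdorffDist {M : Type*} [MetricSpace M] (S T : Set M) : ℝ :=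
  sSup ((fun s => Metric.infDist s T) '' S)

end Metrics

/-! ### Principal angles and the Grassmann angle -/

section GrassmannAngle

variable {𝕜 : Type*} [RCLike 𝕜] {X : Type*} [NormedAddCommGroup X] [InnerProductSpace 𝕜 X]
  [FiniteDimensional 𝕜 X]

/-- `0 ≤ θ₁ ≤ … ≤ θₘ ≤ π/2`, `m = min (dim V) (dim W)`, are the principal angles of `V` and `W`:
there are orthonormal bases `(eᵢ)` of `V` and `(fⱼ)` of `W` with `⟪eᵢ, fⱼ⟫ = δᵢⱼ cos θᵢ`. -/
def IsPrincipalAngles (V W : Submodule 𝕜 X) (θ : Fin (min (finrank 𝕜 V) (finrank 𝕜 W)) → ℝ) :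
    Prop :=
  Monotone θ ∧ (∀ i, θ i ∈ Set.Icc 0 (Real.pi / 2)) ∧
    ∃ (e : OrthonormalBasis (Fin (finrank 𝕜 V)) 𝕜 V) (f : OrthonormalBasis (Fin (finrank 𝕜 W)) 𝕜 W),
      ∀ i j, inner 𝕜 (e i : X) (f j : X) =
        if h : (i : ℕ) = j then
          ((Real.cos (θ ⟨i, lt_min i.isLt (by rw [h]; exact j.isLt)⟩) : ℝ) : 𝕜)
        else 0

theorem exists_isPrincipalAngles (V W : Submodule 𝕜 X) : ∃ θ, IsPrincipalAngles V W θ := by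
  classical
  set T : V →ₗ[𝕜] W := W.orthogonalProjectionOnto.toLinearMap ∘ₗ V.subtype with hT
  have hTin (v : V) (w : W) : inner 𝕜 (v : X) (w : X) = inner 𝕜 (T v) w := by
    exact (Submodule.inner_orthogonalProjectionOnto_eq_of_mem_right w (v : X)).symm
  have hTle (v : V) : ‖T v‖ ≤ ‖v‖ :=
    W.norm_orthogonalProjectionOnto_apply_le (v : X)
  have hS : (LinearMap.adjoint T ∘ₗ T).IsSymmetric := LinearMap.isSymmetric_adjoint_comp_self T
  set e := hS.eigenvectorBasis rfl with he
  set l := hS.eigenvalues rfl with hl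
  have hTT (i j) : inner 𝕜 (T (e i)) (T (e j)) = if i = j then ((l j : ℝ) : 𝕜) else 0 := by
    rw [← LinearMap.adjoint_inner_right, ← LinearMap.comp_apply, hS.apply_eigenvectorBasis,
      inner_smul_right, ← he, orthonormal_iff_ite.mp e.orthonormal]
    simp [hl]
  have hnorm (i) : l i = ‖T (e i)‖ ^ 2 := by
    have h := hTT i i
    rw [if_pos rfl, inner_self_eq_norm_sq_to_K] at h
    exact_mod_cast h.symm
  have hanti : Antitone l := hS.eigenvalues_antitone rfl
  have hanti' {i j} (h : i ≤ j) : ‖T (e j)‖ ≤ ‖T (e i)‖ := by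
    have := hanti h
    rw [hnorm, hnorm] at this
    exact (sq_le_sq₀ (norm_nonneg _) (norm_nonneg _)).mp this
  have hrank (i) (hi : T (e i) ≠ 0) : (i : ℕ) < finrank 𝕜 W := by
    let g : Fin (i + 1) → W := fun k => T (e ⟨k, by omega⟩)
    have hg : LinearIndependent 𝕜 g := by
      refine linearIndependent_of_ne_zero_of_inner_eq_zero (𝕜 := 𝕜) (fun k h => hi ?_) fun k k' hk => ?_
      · have h1 := hanti' (i := ⟨k, by omega⟩) (j := i) (Fin.le_def.mpr (by simp; omega))
        rw [show T (e ⟨k, by omega⟩) = 0 from h, norm_zero] at h1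
        exact norm_le_zero_iff.mp h1
      · show inner 𝕜 (T _) (T _) = 0
        rw [hTT, if_neg]
        simpa [Fin.ext_iff] using hk
    simpa using hg.fintype_card_le_finrank
  let v : Fin (finrank 𝕜 W) → W := fun j =>
    if h : (j : ℕ) < finrank 𝕜 V then ((‖T (e ⟨j, h⟩)‖⁻¹ : ℝ) : 𝕜) • T (e ⟨j, h⟩) else 0
  let s : Set (Fin (finrank 𝕜 W)) := {j | ∃ h : (j : ℕ) < finrank 𝕜 V, T (e ⟨j, h⟩) ≠ 0}
  have hv : Orthonormal 𝕜 (s.domRestrict v) := by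
    rw [orthonormal_iff_ite]
    rintro ⟨j, hj, hj0⟩ ⟨k, hk, hk0⟩
    have hj1 : ((‖T (e ⟨j, hj⟩)‖ : ℝ) : 𝕜) ≠ 0 := by simpa using hj0
    simp only [Set.domRestrict_apply, v, dif_pos hj, dif_pos hk, inner_smul_left, inner_smul_right,
      hTT, hnorm, Subtype.mk.injEq, Fin.ext_iff]
    by_cases h : (j : ℕ) = k
    · obtain rfl : j = k := Fin.ext h
      simp only [if_true, RCLike.conj_ofReal]
      push_cast
      field_simp
    · simp [h]
  obtain ⟨f, hf⟩ := hv.exists_orthonormalBasis_extension_of_card_eq (by simp)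
  have hf' (j : Fin (finrank 𝕜 W)) (h : (j : ℕ) < finrank 𝕜 V) (h0 : T (e ⟨j, h⟩) ≠ 0) :
      T (e ⟨j, h⟩) = ((‖T (e ⟨j, h⟩)‖ : ℝ) : 𝕜) • f j := by
    rw [hf j ⟨h, h0⟩]
    simp only [v, dif_pos h, smul_smul]
    rw [← RCLike.ofReal_mul, mul_inv_cancel₀ (norm_ne_zero_iff.mpr h0)]
    simp
  have hle1 (i) : ‖T (e i)‖ ≤ 1 := (hTle _).trans (e.orthonormal.1 i).le
  refine ⟨fun i => Real.arccos ‖T (e ⟨i, lt_of_lt_of_le i.isLt (min_le_left _ _)⟩)‖, ?_, ?_, e, f, ?_⟩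
  · intro i j hij
    exact Real.arccos_le_arccos (hanti' hij)
  · intro i
    exact ⟨Real.arccos_nonneg _, Real.arccos_le_pi_div_two.mpr (norm_nonneg _)⟩
  · intro i j
    rw [hTin]
    have hcos : Real.cos (Real.arccos ‖T (e i)‖) = ‖T (e i)‖ :=
      Real.cos_arccos (by linarith [norm_nonneg (T (e i))]) (hle1 i)
    by_cases h0 : T (e i) = 0
    · simp [h0]
    · have hi := hrank i h0
      rw [hf' ⟨i, hi⟩ i.isLt h0, inner_smul_left, orthonormal_iff_ite.mp f.orthonormal]
      by_cases hij : (i : ℕ) = j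
      · obtain rfl : (⟨i, hi⟩ : Fin (finrank 𝕜 W)) = j := Fin.ext hij
        rw [if_pos rfl, mul_one, RCLike.conj_ofReal, dif_pos hij, hcos]
      · have : (⟨i, hi⟩ : Fin (finrank 𝕜 W)) ≠ j := fun h => hij (by rw [← h])
        simp [this, hij]

/-- The principal angles `θ₁ ≤ … ≤ θₘ` of `V` and `W` (they are uniquely determined). -/
def principalAngles (V W : Submodule 𝕜 X) : Fin (min (finrank 𝕜 V) (finrank 𝕜 W)) → ℝ :=
  (exists_isPrincipalAngles V W).choose

theorem principalAngles_spec (V W : Submodule 𝕜 X) :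
    IsPrincipalAngles V W (principalAngles V W) :=
  (exists_isPrincipalAngles V W).choose_spec

/-- The Grassmann angle `Θ_{V,W}`. For `V = 0` the product is empty and the angle is `0`. For
`V ≠ 0` and `W = 0` it is `π / 2`. -/
def grassmannAngle (V W : Submodule 𝕜 X) : ℝ :=
  if finrank 𝕜 V ≤ finrank 𝕜 W then Real.arccos (∏ i, Real.cos (principalAngles V W i))
  else Real.pi / 2

end GrassmannAngle

/-! ### Full sub-Grassmannians -/

section Grassmannians

variable {𝕜 : Type*} [RCLike 𝕜] {X : Type*} [NormedAddCommGroup X] [InnerProductSpace 𝕜 X]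
  [FiniteDimensional 𝕜 X]

/-- The line `Λᵏ U ⊆ ΛX` of a `k`-dimensional subspace `U` of `X`. -/
def topPower (U : Submodule 𝕜 X) : Submodule 𝕜 (ExteriorAlgebra 𝕜 X) :=
  (⋀[𝕜]^(finrank 𝕜 U) U).map (ExteriorAlgebra.map U.subtype).toLinearMap

theorem finrank_topPower (U : Submodule 𝕜 X) : finrank 𝕜 (topPower U) = 1 := by
  have hinj : Function.Injective (ExteriorAlgebra.map U.subtype).toLinearMap :=
    ExteriorAlgebra.map_injective_field U.ker_subtype
  rw [topPower, ← (Submodule.equivMapOfInjective _ hinj _).finrank_eq, exteriorPower.finrank_eq,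
    Nat.choose_self]

/-- The Plücker embedding `U ↦ Λᵏ U`, `k = dim U`, of the full Grassmannian of `X` into the
projective space of `ΛX`. -/
def plucker (U : Submodule 𝕜 X) : Projectivization 𝕜 (ExteriorAlgebra 𝕜 X) :=
  Projectivization.mk'' (topPower U) (finrank_topPower U)

/-- The full Grassmannian `G(V)` of all subspaces of `V`, as a subset of `ℙ(ΛX)`. -/
def fullGrassmannian (V : Submodule 𝕜 X) : Set (Projectivization 𝕜 (ExteriorAlgebra 𝕜 X)) :=
  plucker '' {U | U ≤ V}

/-- The full Grassmannian of oriented subspaces of `V`, as a subset of the unit sphere of `ΛX`.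
An orientation of a `k`-dimensional subspace `U` is a unit element of `Λᵏ U`. -/
def orientedFullGrassmannian (V : Submodule 𝕜 X) : Set (AngularSphere 𝕜 (ExteriorAlgebra 𝕜 X)) :=
  {ν | ∃ U : Submodule 𝕜 X, U ≤ V ∧ ν.1 ∈ topPower U}

end Grassmannians
end

/-! ### Gram determinants of contracted families -/

section Fischer

open Matrix ComplexOrder

variable {𝕜 : Type*} [RCLike 𝕜] {m n : Type*} [Fintype m] [Fintype n] [DecidableEq m]
  [DecidableEq n]

/-! Let `P` be the outermorphism of `ΛX` extending the orthogonal projection onto `W` (`bladeProj`).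
It maps blades to blades of `W` (or to 0) and satisfies `⟪ν, ω⟫ = ⟪P ν, ω⟫` for every blade `ω` of
`W`. For a unit blade `ν`, Cauchy–Schwarz then gives `|⟪ν, ω⟫| ≤ ‖P ν‖` over unit blades `ω` of `W`.
Equality is reached at `P ν / ‖P ν‖`, where the inner product is real and nonnegative. So in both
metric spaces the distance from `ν` to the Grassmannian of `W` is `arccos ‖P ν‖`, and it is
attained.

It remains to minimise `‖P ν‖` over the subspaces `U` of `V`. The minimum is at `U = V`: extend an
orthonormal basis of `U` to one of `V`; the squared norms of the projected blades are Gram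
determinants, and adjoining images of orthonormal vectors under a contraction cannot increase such a
determinant. This is a form of Fischer's inequality (`det_gram_contraction_le`,
`norm_bladeProj_le_of_le`).

For `V` itself, principal bases diagonalise the projection, so `‖P μ‖` is the product of the cosines
when `dim V ≤ dim W`, and 0 otherwise (`arccos_norm_bladeProj`). -/

theorem Matrix.PosSemidef.det_le_one {S : Matrix n n 𝕜} (hS : S.PosSemidef)
    (h1 : (1 - S).PosSemidef) : S.det ≤ 1 := by
  -- Test `1 - S ≥ 0` on a unit eigenvector of `S`.
  have hle (i) : hS.1.eigenvalues i ≤ 1 := by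
    set x : n → 𝕜 := (hS.1.eigenvectorBasis i).ofLp with hx
    have hxx : star x ⬝ᵥ x = 1 := by
      have h := hS.1.eigenvectorBasis.orthonormal.1 i
      have h2 := inner_self_eq_norm_sq_to_K (𝕜 := 𝕜) (hS.1.eigenvectorBasis i)
      rw [h, EuclideanSpace.inner_eq_star_dotProduct, dotProduct_comm] at h2
      simpa using h2
    have h := h1.dotProduct_mulVec_nonneg x
    rw [sub_mulVec, one_mulVec, hx, hS.1.mulVec_eigenvectorBasis i, ← hx, dotProduct_sub,
      dotProduct_smul, hxx, RCLike.real_smul_eq_coe_mul, mul_one, sub_nonneg] at h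
    exact_mod_cast h
  rw [hS.1.det_eq_prod_eigenvalues]
  have := Finset.prod_le_one (s := Finset.univ) (fun i _ => hS.eigenvalues_nonneg i)
    (fun i _ => hle i)
  exact_mod_cast this

/-- A special case of Fischer's inequality for block matrices. -/
theorem Matrix.PosSemidef.det_fromBlocks_le_det {A : Matrix m m 𝕜} {B : Matrix m n 𝕜}
    {D : Matrix n n 𝕜} (hM : (fromBlocks A B Bᴴ D).PosSemidef) (hD : (1 - D).PosSemidef) :
    (fromBlocks A B Bᴴ D).det ≤ A.det := by
  have hA : A.PosSemidef := by simpa using! hM.submatrix Sum.inl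
  -- In the nonsingular case the block matrix, and hence `A`, is positive definite, so the Schur
  -- complement of `A` exists.
  by_cases h0 : (fromBlocks A B Bᴴ D).det = 0
  · rw [h0]
    exact hA.det_nonneg
  · have hM' := hM.posDef_iff_det_ne_zero.mpr h0
    have hA' : A.PosDef := by simpa using! hM'.submatrix Sum.inl_injective
    let _ : Invertible A := hA'.isUnit.invertible
    rw [det_fromBlocks₁₁, invOf_eq_nonsing_inv]
    have hS : (D - Bᴴ * A⁻¹ * B).PosSemidef := (PosDef.fromBlocks₁₁ B D hA').mp hM
    -- `1 - S = (1 - D) + Bᴴ A⁻¹ B` is a sum of positive semidefinite matrices, so the Schur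
    -- complement contributes a factor at most 1.
    have hS1 : (1 - (D - Bᴴ * A⁻¹ * B)).PosSemidef := by
      rw [sub_sub_eq_add_sub, add_sub_right_comm]
      exact hD.add (hA'.inv.posSemidef.conjTranspose_mul_mul_same B)
    exact mul_le_of_le_one_right hA'.det_pos.le (hS.det_le_one hS1)

/-- Removing vectors from a family of the form `T ∘ e`, with `T` a contraction and `e` orthonormal,
does not decrease the Gram determinant. -/
theorem det_gram_contraction_le {E F : Type*} [NormedAddCommGroup E] [InnerProductSpace 𝕜 E]
    [NormedAddCommGroup F] [InnerProductSpace 𝕜 F] (T : E →L[𝕜] F) (hT : ‖T‖ ≤ 1)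
    (u : m → E) (v : n → E) (hv : Orthonormal 𝕜 v) :
    (gram 𝕜 (T ∘ Sum.elim u v)).det ≤ (gram 𝕜 (T ∘ u)).det := by
  have hblock : gram 𝕜 (T ∘ Sum.elim u v) = fromBlocks (gram 𝕜 (T ∘ u))
      (of fun i j => inner 𝕜 (T (u i)) (T (v j)))
      (of fun i j => inner 𝕜 (T (u i)) (T (v j)))ᴴ (gram 𝕜 (T ∘ v)) := by
    ext (i | i) (j | j) <;> simp [gram_apply]
  have h := posSemidef_gram 𝕜 (T ∘ Sum.elim u v)
  rw [hblock] at h ⊢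
  refine h.det_fromBlocks_le_det ?_
  -- The bound required is `gram (T ∘ v) ≤ 1`. It follows by adding `(1 - ‖T‖²) gram v ≥ 0` to `‖T‖²
  -- gram v - gram (T ∘ v) ≥ 0`, since `gram v = 1`.
  have h1 := posSemidef_opNorm_smul_gram_sub_gram (𝕜 := 𝕜) v T
  have h2 : ((1 - ‖T‖ ^ 2) • gram 𝕜 v).PosSemidef :=
    (posSemidef_gram 𝕜 v).smul (sub_nonneg.mpr (pow_le_one₀ (norm_nonneg _) hT))
  have h3 := h2.add h1
  rw [sub_smul, one_smul, sub_add_sub_cancel, gram_eq_one_iff_orthonormal.mpr hv] at h3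
  exact h3

end Fischer

theorem orthonormal_coe_basis {𝕜 : Type*} [RCLike 𝕜] {X : Type*} [NormedAddCommGroup X]
    [InnerProductSpace 𝕜 X] {ι : Type*} [Fintype ι] {U : Submodule 𝕜 X}
    (e : OrthonormalBasis ι 𝕜 U) : Orthonormal 𝕜 fun i => (e i : X) :=
  e.orthonormal.comp_linearIsometry U.subtypeₗᵢ

/-! ### Blades and their projection onto a subspace -/

section TopPower

variable {𝕜 : Type*} [RCLike 𝕜] {X : Type*} [NormedAddCommGroup X] [InnerProductSpace 𝕜 X]
  [FiniteDimensional 𝕜 X]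

theorem norm_sq_ιMulti {k : ℕ} (v : Fin k → X) :
    ((‖ExteriorAlgebra.ιMulti 𝕜 k v‖ ^ 2 : ℝ) : 𝕜) = (Matrix.gram 𝕜 v).det := by
  rw [RCLike.ofReal_pow, ← inner_self_eq_norm_sq_to_K (𝕜 := 𝕜), inner_ιMulti_ιMulti]
  rfl

theorem norm_ιMulti_of_orthonormal {k : ℕ} {v : Fin k → X} (hv : Orthonormal 𝕜 v) :
    ‖ExteriorAlgebra.ιMulti 𝕜 k v‖ = 1 := by
  have h := norm_sq_ιMulti (𝕜 := 𝕜) v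
  rw [Matrix.gram_eq_one_iff_orthonormal.mpr hv, Matrix.det_one] at h
  have h' : ‖ExteriorAlgebra.ιMulti 𝕜 k v‖ ^ 2 = 1 := by exact_mod_cast h
  exact (pow_eq_one_iff_of_nonneg (norm_nonneg _) two_ne_zero).mp h'

theorem ιMulti_mem_topPower {k : ℕ} {U : Submodule 𝕜 X} (hk : finrank 𝕜 U = k) {v : Fin k → X}
    (hv : ∀ i, v i ∈ U) : ExteriorAlgebra.ιMulti 𝕜 k v ∈ topPower U := by
  subst hk
  refine ⟨ExteriorAlgebra.ιMulti 𝕜 _ fun i => (⟨v i, hv i⟩ : U),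
    ExteriorAlgebra.ιMulti_range 𝕜 _ (Set.mem_range_self _), ?_⟩
  exact ExteriorAlgebra.map_apply_ιMulti _ _

/-- The wedge of an orthonormal basis is a unit vector in the line `topPower U`, hence spans it.
This allows the basis to be chosen to suit each argument. -/
theorem exists_smul_ιMulti_eq {k : ℕ} {U : Submodule 𝕜 X} (hk : finrank 𝕜 U = k) {v : Fin k → X}
    (hv : ∀ i, v i ∈ U) (hv' : Orthonormal 𝕜 v) {ν : ExteriorAlgebra 𝕜 X} (hν : ν ∈ topPower U) :
    ∃ c : 𝕜, ‖c‖ = ‖ν‖ ∧ c • ExteriorAlgebra.ιMulti 𝕜 k v = ν := by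
  have hn := norm_ιMulti_of_orthonormal hv'
  have h0 : (⟨_, ιMulti_mem_topPower hk hv⟩ : topPower U) ≠ 0 := fun h => by
    rw [show ExteriorAlgebra.ιMulti 𝕜 k v = 0 from Subtype.ext_iff.mp h, norm_zero] at hn
    exact zero_ne_one hn
  obtain ⟨c, hc⟩ := exists_smul_eq_of_finrank_eq_one (finrank_topPower U) h0 ⟨ν, hν⟩
  have hc' : c • ExteriorAlgebra.ιMulti 𝕜 k v = ν := Subtype.ext_iff.mp hc
  exact ⟨c, by rw [← hc', norm_smul, hn, mul_one], hc'⟩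

theorem exists_unit_mem_topPower (U : Submodule 𝕜 X) :
    ∃ ν ∈ topPower U, ‖ν‖ = 1 :=
  ⟨_, ιMulti_mem_topPower rfl fun i => (stdOrthonormalBasis 𝕜 U i).2,
    norm_ιMulti_of_orthonormal (orthonormal_coe_basis _)⟩

/-- The outermorphism `ΛX → ΛX` that extends the orthogonal projection onto `W`. -/
noncomputable def bladeProj (W : Submodule 𝕜 X) : ExteriorAlgebra 𝕜 X →ₐ[𝕜] ExteriorAlgebra 𝕜 X :=
  ExteriorAlgebra.map W.starProjection.toLinearMap

theorem bladeProj_ιMulti (W : Submodule 𝕜 X) {k : ℕ} (v : Fin k → X) :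
    bladeProj W (ExteriorAlgebra.ιMulti 𝕜 k v)
      = ExteriorAlgebra.ιMulti 𝕜 k (W.starProjection ∘ v) :=
  ExteriorAlgebra.map_apply_ιMulti _ _

theorem inner_ιMulti_of_ne {k l : ℕ} (h : k ≠ l) (v : Fin k → X) (w : Fin l → X) :
    inner 𝕜 (ExteriorAlgebra.ιMulti 𝕜 k v) (ExteriorAlgebra.ιMulti 𝕜 l w) = 0 :=
  inner_eq_zero_of_grade_ne h (exteriorPower.ιMulti 𝕜 k v) (exteriorPower.ιMulti 𝕜 l w)

theorem exists_smul_ιMulti_stdBasis {U : Submodule 𝕜 X} {ν : ExteriorAlgebra 𝕜 X}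
    (hν : ν ∈ topPower U) : ∃ c : 𝕜, ‖c‖ = ‖ν‖ ∧
      c • ExteriorAlgebra.ιMulti 𝕜 _ (fun i => (stdOrthonormalBasis 𝕜 U i : X)) = ν :=
  exists_smul_ιMulti_eq rfl (fun i => (stdOrthonormalBasis 𝕜 U i).2) (orthonormal_coe_basis _) hν

/-- The projection is self-adjoint and fixes the vectors of `U'`, so the two determinants agree
entry by entry. In unequal grades both sides vanish, since the outermorphism preserves grade. -/
theorem inner_bladeProj_left {W U U' : Submodule 𝕜 X} (hU' : U' ≤ W) {ν ω : ExteriorAlgebra 𝕜 X}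
    (hν : ν ∈ topPower U) (hω : ω ∈ topPower U') :
    inner 𝕜 (bladeProj W ν) ω = inner 𝕜 ν ω := by
  obtain ⟨c, -, rfl⟩ := exists_smul_ιMulti_stdBasis hν
  obtain ⟨d, -, rfl⟩ := exists_smul_ιMulti_stdBasis hω
  rw [map_smul, bladeProj_ιMulti, inner_smul_left, inner_smul_right, inner_smul_left,
    inner_smul_right]
  by_cases h : finrank 𝕜 U = finrank 𝕜 U'
  · revert h
    -- The bases depend on the dimensions, so they are generalised first to let the equality of
    -- dimensions be substituted.
    generalize stdOrthonormalBasis 𝕜 U = e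
    generalize stdOrthonormalBasis 𝕜 U' = f
    generalize finrank 𝕜 U = k at e ⊢
    intro h
    subst h
    rw [inner_ιMulti_ιMulti, inner_ιMulti_ιMulti]
    congr 4
    funext i j
    rw [Function.comp_apply, Submodule.inner_starProjection_left_eq_right,
      Submodule.starProjection_eq_self_iff.mpr (hU' (f j).2)]
  · rw [inner_ιMulti_of_ne h, inner_ιMulti_of_ne h]

theorem exists_bladeProj_mem_topPower (W : Submodule 𝕜 X) {U : Submodule 𝕜 X}
    {ν : ExteriorAlgebra 𝕜 X} (hν : ν ∈ topPower U) : ∃ U' ≤ W, bladeProj W ν ∈ topPower U' := by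
  obtain ⟨c, -, rfl⟩ := exists_smul_ιMulti_stdBasis hν
  set v := W.starProjection ∘ fun i => (stdOrthonormalBasis 𝕜 U i : X) with hv
  simp only [map_smul, bladeProj_ιMulti, ← hv]
  by_cases h : LinearIndependent 𝕜 v
  · refine ⟨Submodule.span 𝕜 (Set.range v), ?_, ?_⟩
    · rw [Submodule.span_le]
      rintro _ ⟨i, rfl⟩
      exact W.starProjection_apply_mem _
    · refine Submodule.smul_mem _ _ (ιMulti_mem_topPower ?_ fun i =>
        Submodule.subset_span (Set.mem_range_self i))
      rw [finrank_span_eq_card h, Fintype.card_fin]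
  -- The projected blade is 0 here and lies in every line; `⊥` is just one subspace of `W`.
  · refine ⟨⊥, bot_le, ?_⟩
    rw [AlternatingMap.map_linearDependent _ _ h, smul_zero]
    exact Submodule.zero_mem _

open ComplexOrder in
-- Larger subspaces have smaller projected unit blades: an orthonormal basis `e` of `U` is completed
-- by an orthonormal basis `f` of `Uᗮ ⊓ V`, and the Gram determinant inequality applies to the
-- projection.
theorem norm_bladeProj_le_of_le (W : Submodule 𝕜 X) {U V : Submodule 𝕜 X} (hUV : U ≤ V)
    {ν μ : ExteriorAlgebra 𝕜 X} (hν : ν ∈ topPower U) (hμ : μ ∈ topPower V) (hν1 : ‖ν‖ = 1)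
    (hμ1 : ‖μ‖ = 1) : ‖bladeProj W μ‖ ≤ ‖bladeProj W ν‖ := by
  obtain ⟨c, hc, rfl⟩ := exists_smul_ιMulti_stdBasis hν
  set e : Fin (finrank 𝕜 U) → X := fun i => (stdOrthonormalBasis 𝕜 U i : X) with he
  have hee : Orthonormal 𝕜 e := orthonormal_coe_basis _
  set U' : Submodule 𝕜 X := Uᗮ ⊓ V with hU'
  set f : Fin (finrank 𝕜 U') → X := fun i => (stdOrthonormalBasis 𝕜 U' i : X) with hf
  have hff : Orthonormal 𝕜 f := orthonormal_coe_basis _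
  have hdim : finrank 𝕜 V = finrank 𝕜 U + finrank 𝕜 U' :=
    (Submodule.finrank_add_inf_finrank_orthogonal hUV).symm
  have hg : Orthonormal 𝕜 (Sum.elim e f) := by
    have hef (i j) : inner 𝕜 (e i) (f j) = 0 :=
      (stdOrthonormalBasis 𝕜 U' j).2.1 _ (stdOrthonormalBasis 𝕜 U i).2
    rw [orthonormal_iff_ite]
    rintro (i | i) (j | j)
    · simpa using orthonormal_iff_ite.mp hee i j
    · simpa using hef i j
    · simpa using inner_eq_zero_symm.mp (hef j i)
    · simpa using orthonormal_iff_ite.mp hff i j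
  have hgV (i) : Sum.elim e f i ∈ V := by
    rcases i with i | i
    · exact hUV (stdOrthonormalBasis 𝕜 U i).2
    · exact (stdOrthonormalBasis 𝕜 U' i).2.2
  obtain ⟨d, hd, rfl⟩ := exists_smul_ιMulti_eq hdim (v := Sum.elim e f ∘ finSumFinEquiv.symm)
    (fun i => hgV _) (hg.comp _ finSumFinEquiv.symm.injective) hμ
  rw [map_smul, map_smul, norm_smul, norm_smul, hc, hd, hν1, hμ1, one_mul, one_mul,
    bladeProj_ιMulti, bladeProj_ιMulti]
  refine (sq_le_sq₀ (norm_nonneg _) (norm_nonneg _)).mp ?_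
  have h := det_gram_contraction_le W.starProjection W.starProjection_norm_le e f hff
  rw [← RCLike.ofReal_le_ofReal (K := 𝕜), norm_sq_ιMulti, norm_sq_ιMulti]
  refine le_of_eq_of_le ?_ h
  exact Matrix.det_submatrix_equiv_self finSumFinEquiv.symm
    (Matrix.gram 𝕜 (W.starProjection ∘ Sum.elim e f))

/-- In principal bases `eᵢ` projects to `cos θᵢ • fᵢ`, so the unit blade of `V` projects to a unit
blade times the product of the cosines. If `dim V > dim W`, the projected basis is linearly
dependent and its wedge is 0. -/
theorem arccos_norm_bladeProj (V W : Submodule 𝕜 X) {μ : ExteriorAlgebra 𝕜 X}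
    (hμ : μ ∈ topPower V) (hμ1 : ‖μ‖ = 1) :
    Real.arccos ‖bladeProj W μ‖ = grassmannAngle V W := by
  rw [grassmannAngle]
  split_ifs with h
  · obtain ⟨-, hθ, e, f, hef⟩ := principalAngles_spec V W
    obtain ⟨c, hc, rfl⟩ := exists_smul_ιMulti_eq rfl (fun i => (e i).2) (orthonormal_coe_basis e) hμ
    set r : Fin (finrank 𝕜 V) → ℝ :=
      fun i => Real.cos (principalAngles V W (Fin.cast (min_eq_left h).symm i)) with hr
    have hproj : (W.starProjection ∘ fun i => (e i : X))
        = fun i => (r i : 𝕜) • (f (Fin.castLE h i) : X) := by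
      funext i
      refine Submodule.eq_starProjection_of_mem_of_inner_eq_zero
        (W.smul_mem _ (f _).2) fun w hw => ?_
      -- The residual need only be orthogonal to each `f j`: both terms give `cos θᵢ` for `j = i`
      -- and 0 otherwise.
      have hlin : ∀ w : W, inner 𝕜 ((e i : X) - (r i : 𝕜) • (f (Fin.castLE h i) : X)) (w : X) = 0 := by
        intro w
        rw [← f.sum_repr w]
        simp only [Submodule.coe_sum, Submodule.coe_smul, inner_sum, inner_smul_right]
        refine Finset.sum_eq_zero fun j _ => ?_
        rw [inner_sub_left, hef, inner_smul_left, RCLike.conj_ofReal,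
          orthonormal_iff_ite.mp (orthonormal_coe_basis f)]
        by_cases hij : (i : ℕ) = j
        · obtain rfl : Fin.castLE h i = j := Fin.ext hij
          simp [hr]
          right
          exact sub_self _
        · have : Fin.castLE h i ≠ j := fun h' => hij (by rw [← h']; rfl)
          simp [hij, this]
      exact hlin ⟨w, hw⟩
    have hf : Orthonormal 𝕜 fun i => (f (Fin.castLE h i) : X) :=
      (orthonormal_coe_basis f).comp _ (Fin.castLE_injective h)
    rw [map_smul, norm_smul, hc, hμ1, one_mul, bladeProj_ιMulti, hproj,
      AlternatingMap.map_smul_univ, norm_smul, norm_ιMulti_of_orthonormal hf, mul_one, norm_prod]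
    congr 1
    refine Fintype.prod_equiv (finCongr (min_eq_left h).symm) _ _ fun i => ?_
    rw [RCLike.norm_ofReal, abs_of_nonneg]
    · rfl
    · exact Real.cos_nonneg_of_mem_Icc
        ⟨by linarith [(hθ (Fin.cast (min_eq_left h).symm i)).1, Real.pi_pos], (hθ _).2⟩
  · obtain ⟨c, -, rfl⟩ := exists_smul_ιMulti_stdBasis hμ
    rw [map_smul, bladeProj_ιMulti, AlternatingMap.map_linearDependent, smul_zero, norm_zero,
      Real.arccos_zero]
    intro hli
    have hli' : LinearIndependent 𝕜 fun i => (⟨_, W.starProjection_apply_mem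
        (stdOrthonormalBasis 𝕜 V i : X)⟩ : W) := hli.of_comp W.subtype
    exact h (by simpa using hli'.fintype_card_le_finrank)

end TopPower

/-! ### Nearest points and Hausdorff distances -/

section Hausdorff

theorem infDist_eq_of_forall_le {M : Type*} [MetricSpace M] {s t : M} {T : Set M} (ht : t ∈ T)
    (h : ∀ t' ∈ T, dist s t ≤ dist s t') : Metric.infDist s T = dist s t :=
  le_antisymm (Metric.infDist_le_dist_of_mem ht) ((Metric.le_infDist ⟨t, ht⟩).mpr fun {t'} => h t')

variable {𝕜 : Type*} [RCLike 𝕜] {X : Type*} [NormedAddCommGroup X] [InnerProductSpace 𝕜 X]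
  [FiniteDimensional 𝕜 X]

theorem dist_plucker {U U' : Submodule 𝕜 X} {ν ω : ExteriorAlgebra 𝕜 X} (hν : ν ∈ topPower U)
    (hω : ω ∈ topPower U') (hν1 : ‖ν‖ = 1) (hω1 : ‖ω‖ = 1) :
    dist (plucker U) (plucker U') = Real.arccos ‖(inner 𝕜 ν ω : 𝕜)‖ := by
  -- Any nonzero element of `topPower U` represents the point `plucker U`, so unit representatives
  -- may be used.
  have key {U : Submodule 𝕜 X} {ν : ExteriorAlgebra 𝕜 X} (hν : ν ∈ topPower U) (h0 : ν ≠ 0) :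
      plucker U = Projectivization.mk 𝕜 ν h0 := by
    apply Projectivization.submodule_injective
    rw [plucker, Projectivization.submodule_mk'', Projectivization.submodule_mk]
    exact (finrank_eq_one_iff_of_nonzero' (⟨ν, hν⟩ : topPower U) (by simpa using h0)).mp
      (finrank_topPower U) |> fun h => le_antisymm
        (fun x hx => by
          obtain ⟨c, hc⟩ := h ⟨x, hx⟩
          exact Submodule.mem_span_singleton.mpr ⟨c, Subtype.ext_iff.mp hc⟩)
        ((Submodule.span_singleton_le_iff_mem _ _).mpr hν)
  have hν0 : ν ≠ 0 := by rintro rfl; simp at hν1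
  have hω0 : ω ≠ 0 := by rintro rfl; simp at hω1
  rw [key hν hν0, key hω hω0, fubiniStudy_dist_mk, hν1, hω1, mul_one, div_one]

theorem norm_inner_le_norm_bladeProj {W U U' : Submodule 𝕜 X} (hU' : U' ≤ W)
    {ν ω : ExteriorAlgebra 𝕜 X} (hν : ν ∈ topPower U) (hω : ω ∈ topPower U') (hω1 : ‖ω‖ = 1) :
    ‖(inner 𝕜 ν ω : 𝕜)‖ ≤ ‖bladeProj W ν‖ := by
  rw [← inner_bladeProj_left hU' hν hω]
  simpa [hω1] using norm_inner_le_norm (𝕜 := 𝕜) (bladeProj W ν) ω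

/-- The unit blade of `W` closest to a given blade. -/
theorem exists_inner_eq_norm_bladeProj (W : Submodule 𝕜 X) {U : Submodule 𝕜 X}
    {ν : ExteriorAlgebra 𝕜 X} (hν : ν ∈ topPower U) :
    ∃ U' ≤ W, ∃ ω ∈ topPower U', ‖ω‖ = 1 ∧ inner 𝕜 ν ω = ((‖bladeProj W ν‖ : ℝ) : 𝕜) := by
  obtain ⟨U', hU', h⟩ := exists_bladeProj_mem_topPower W hν
  -- If the projection vanishes, `ν` is orthogonal to all blades of `W` and any unit blade serves;
  -- otherwise the normalised projection is taken.
  by_cases h0 : bladeProj W ν = 0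
  · obtain ⟨ω, hω, hω1⟩ := exists_unit_mem_topPower U'
    refine ⟨U', hU', ω, hω, hω1, ?_⟩
    rw [← inner_bladeProj_left hU' hν hω, h0]
    simp
  · have hn : ‖bladeProj W ν‖ ≠ 0 := norm_ne_zero_iff.mpr h0
    have hm : ((‖bladeProj W ν‖⁻¹ : ℝ) : 𝕜) • bladeProj W ν ∈ topPower U' :=
      Submodule.smul_mem _ _ h
    refine ⟨U', hU', _, hm, ?_, ?_⟩
    · rw [norm_smul, RCLike.norm_ofReal, abs_of_nonneg (by positivity), inv_mul_cancel₀ hn]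
    · rw [← inner_bladeProj_left hU' hν hm, inner_smul_right, inner_self_eq_norm_sq_to_K,
        ← RCLike.ofReal_pow, ← RCLike.ofReal_mul]
      congr 1
      field_simp

theorem exists_dist_eq_infDist_fullGrassmannian (W : Submodule 𝕜 X) {U : Submodule 𝕜 X}
    {ν : ExteriorAlgebra 𝕜 X} (hν : ν ∈ topPower U) (hν1 : ‖ν‖ = 1) :
    (∃ t ∈ fullGrassmannian W,
      dist (plucker U) t = Metric.infDist (plucker U) (fullGrassmannian W)) ∧
    Metric.infDist (plucker U) (fullGrassmannian W) = Real.arccos ‖bladeProj W ν‖ := by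
  obtain ⟨U', hU', ω, hω, hω1, h⟩ := exists_inner_eq_norm_bladeProj W hν
  have hd : dist (plucker U) (plucker U') = Real.arccos ‖bladeProj W ν‖ := by
    rw [dist_plucker hν hω hν1 hω1, h, RCLike.norm_ofReal, abs_norm]
  have ht : plucker U' ∈ fullGrassmannian W := ⟨U', hU', rfl⟩
  have hinf : Metric.infDist (plucker U) (fullGrassmannian W) = dist (plucker U) (plucker U') := by
    refine infDist_eq_of_forall_le ht ?_
    rintro _ ⟨U'', hU'', rfl⟩
    obtain ⟨ω', hω', hω1'⟩ := exists_unit_mem_topPower U''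
    rw [hd, dist_plucker hν hω' hν1 hω1']
    exact Real.arccos_le_arccos (norm_inner_le_norm_bladeProj hU'' hν hω' hω1')
  exact ⟨⟨_, ht, hinf.symm⟩, hinf.trans hd⟩

/-- The bound on the modulus also bounds the real part, and the optimal blade has a real nonnegative
inner product with `ν`. Passing from lines to oriented blades therefore changes no distance. -/
theorem exists_dist_eq_infDist_orientedFullGrassmannian (W : Submodule 𝕜 X) {U : Submodule 𝕜 X}
    (ν : AngularSphere 𝕜 (ExteriorAlgebra 𝕜 X)) (hν : ν.1 ∈ topPower U) :
    (∃ ω ∈ orientedFullGrassmannian W,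
      dist ν ω = Metric.infDist ν (orientedFullGrassmannian W)) ∧
    Metric.infDist ν (orientedFullGrassmannian W) = Real.arccos ‖bladeProj W ν.1‖ := by
  obtain ⟨U', hU', ω, hω, hω1, h⟩ := exists_inner_eq_norm_bladeProj W hν
  set t : AngularSphere 𝕜 (ExteriorAlgebra 𝕜 X) := ⟨ω, hω1⟩ with ht'
  have hd : dist ν t = Real.arccos ‖bladeProj W ν.1‖ := by
    show Real.arccos (RCLike.re (inner 𝕜 ν.1 ω)) = _
    rw [h, RCLike.ofReal_re]
  have ht : t ∈ orientedFullGrassmannian W := ⟨U', hU', hω⟩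
  have hinf : Metric.infDist ν (orientedFullGrassmannian W) = dist ν t := by
    refine infDist_eq_of_forall_le ht ?_
    rintro ω' ⟨U'', hU'', hω'⟩
    rw [hd]
    exact Real.arccos_le_arccos
      ((RCLike.re_le_norm _).trans (norm_inner_le_norm_bladeProj hU'' hν hω' ω'.2))
  exact ⟨⟨_, ht, hinf.symm⟩, hinf.trans hd⟩

theorem isGreatest_directedHausdorffDist {M : Type*} [MetricSpace M] {S T : Set M} {a : ℝ}
    (h : IsGreatest ((fun s => Metric.infDist s T) '' S) a) :
    IsGreatest ((fun s => Metric.infDist s T) '' S) (directedHausdorffDist S T) ∧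
      directedHausdorffDist S T = a := by
  have : directedHausdorffDist S T = a := h.csSup_eq
  exact ⟨this ▸ h, this⟩

end Hausdorff

theorem mainTheorem8 {𝕜 : Type*} [RCLike 𝕜] {X : Type*} [NormedAddCommGroup X]
    [InnerProductSpace 𝕜 X] [FiniteDimensional 𝕜 X] (V W : Submodule 𝕜 X) :
    ((∀ s ∈ fullGrassmannian V, ∃ t ∈ fullGrassmannian W,
        dist s t = Metric.infDist s (fullGrassmannian W)) ∧
      IsGreatest ((fun s => Metric.infDist s (fullGrassmannian W)) '' fullGrassmannian V)
        (directedHausdorffDist (fullGrassmannian V) (fullGrassmannian W)) ∧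
      directedHausdorffDist (fullGrassmannian V) (fullGrassmannian W) = grassmannAngle V W) ∧
    ((∀ ν ∈ orientedFullGrassmannian V, ∃ ω ∈ orientedFullGrassmannian W,
        dist ν ω = Metric.infDist ν (orientedFullGrassmannian W)) ∧
      IsGreatest
        ((fun ν => Metric.infDist ν (orientedFullGrassmannian W)) '' orientedFullGrassmannian V)
        (directedHausdorffDist (orientedFullGrassmannian V) (orientedFullGrassmannian W)) ∧
      directedHausdorffDist (orientedFullGrassmannian V) (orientedFullGrassmannian W)
        = grassmannAngle V W) := by
  -- The maximum is attained at `V` itself, represented by a unit blade `μ`; in the oriented case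
  -- any orientation works.
  obtain ⟨μ, hμ, hμ1⟩ := exists_unit_mem_topPower V
  have hμW := arccos_norm_bladeProj V W hμ hμ1
  refine ⟨⟨?_, isGreatest_directedHausdorffDist ⟨⟨plucker V, ⟨V, le_refl V, rfl⟩, ?_⟩, ?_⟩⟩,
    ⟨?_, isGreatest_directedHausdorffDist ⟨⟨⟨μ, hμ1⟩, ⟨V, le_refl V, hμ⟩, ?_⟩, ?_⟩⟩⟩
  · rintro _ ⟨U, -, rfl⟩
    obtain ⟨ν, hν, hν1⟩ := exists_unit_mem_topPower U
    exact (exists_dist_eq_infDist_fullGrassmannian W hν hν1).1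
  · exact (exists_dist_eq_infDist_fullGrassmannian W hμ hμ1).2.trans hμW
  · rintro _ ⟨_, ⟨U, hU, rfl⟩, rfl⟩
    obtain ⟨ν, hν, hν1⟩ := exists_unit_mem_topPower U
    refine (exists_dist_eq_infDist_fullGrassmannian W hν hν1).2.le.trans (le_of_le_of_eq ?_ hμW)
    -- `arccos` is decreasing, so the smallest projected norm, that of `V`, gives the largest
    -- distance.
    exact Real.arccos_le_arccos (norm_bladeProj_le_of_le W hU hν hμ hν1 hμ1)
  · rintro ν ⟨U, -, hν⟩
    exact (exists_dist_eq_infDist_orientedFullGrassmannian W ν hν).1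
  · exact (exists_dist_eq_infDist_orientedFullGrassmannian W ⟨μ, hμ1⟩ hμ).2.trans hμW
  · rintro _ ⟨ν, ⟨U, hU, hν⟩, rfl⟩
    refine (exists_dist_eq_infDist_orientedFullGrassmannian W ν hν).2.le.trans
      (le_of_le_of_eq ?_ hμW)
    exact Real.arccos_le_arccos (norm_bladeProj_le_of_le W hU hν hμ ν.2 hμ1)
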